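/- Let $M$ be a closed Riemann surface of genus $g\ge 1$, $\rho:\widehat M\to M$ its universal cover, and $M_0\subset\widehat M$ a set of representatives (fundamental domain) containing exactly one point over each point of $M$; for $q\in M$ write $\hat q$ for the point of $M_0$ over $q$. Let $\mathcal O_{q}$ be the ring of germs of holomorphic functions at $q$. All residues below are taken with respect to the local coordinate at the point in question (coefficient of $z^{-1}$) and entrywise. **Null-pole divisor.** Let $r\ge 0$ be an integer. A null-pole divisor $\mathcal D$ assigns to every $q\in M$ a local coordinate $z_q$ with $z_q(q)=0$ and matrices $\Upsilon_q=((B_{\zeta_q},A_{\zeta_q}),(A_{\pi_q},C_{\pi_q}),S_q)$ of sizes $r\times n_{\zeta_q}$, $n_{\zeta_q}\times n_{\zeta_q}$, $n_{\pi_q}\times n_{\pi_q}$, $n_{\pi_q}\times r$, $n_{\pi_q}\times n_{\zeta_q}$, such that $A_{\pi_q}$ and $A_{\zeta_q}$ are nilpotent, $(A_{\pi_q},C_{\pi_q})$ is controllable (the ranges of $A_{\pi_q}^jC_{\pi_q}$, $0\le j<n_{\pi_q}$, span $\mathbb C^{n_{\pi_q}}$), $(B_{\zeta_q},A_{\zeta_q})$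 is observable ($\bigcap_{0\le j<n_{\zeta_q}}\ker B_{\zeta_q}A_{\zeta_q}^j=0$), $A_{\pi_q}S_q-S_qA_{\zeta_q}=C_{\pi_q}B_{\zeta_q}$, and $n_{\pi_q}=n_{\zeta_q}=0$ for all but finitely many $q$. The remaining points $u_1,\dots,u_k$ form the support of $\mathcal D$; write $\Upsilon_i,z_i,\dots$ for the data at $u_i$. Let $P$ be the set of indices $i$ with $n_{\pi_i}>0$ and $Z$ the set of indices $j$ with $n_{\zeta_j}>0$. Let $\mathcal S(\Upsilon_q,q)$ be the set of germs at $q$ of the row functions $$\mathbf x(z_qI-A_{\pi_q})^{-1}C_{\pi_q}+\mathbf h,\qquad \mathbf x\in\mathbb C^{1\times n_{\pi_q}},\ \mathbf h\in\mathcal O_q^{1\times r},\ \ \mathbf xS_q=\operatorname{res}_q\bigl[\mathbf h\,B_{\zeta_q}(z_qI-A_{\zeta_q})^{-1}\bigr].$$ **The function $F_{\mathcal D}$.** Let $F_{\mathcal D}$ be any $r\times r$ meromorphic matrix function on $\widehat M$ such that $M$ has an open cover $\{U_\alpha\}$ with $F_{\mathcal D}=H_\alpha\cdot(L_\alpha\circ\rho)$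 on $\rho^{-1}(U_\alpha)$, where $H_\alpha$ is holomorphic and invertible on $\rho^{-1}(U_\alpha)$ and $L_\alpha$ is a nondegenerate meromorphic matrix function on $U_\alpha$ solving the null-pole interpolation problem $\mathcal O_q^{1\times r}L_\alpha=\mathcal S(\Upsilon_q,q)$ for all $q\in U_\alpha$. **The functions $f^{D_0}_{w,A}$.** Let $D_0=p_1+\dots+p_g-p_0$ be a divisor on $M$ with $p_1+\dots+p_g$ nonspecial (the only meromorphic $1$-form $\omega$ with $(\omega)\ge p_1+\dots+p_g$ is $0$), $p_0\ne p_i$ for $1\le i\le g$, and $p_0,\dots,p_g$ outside the support of $\mathcal D$. For $w=u_i$ with $i\in P$ and an integer $m\ge1$ let $f^{D_0}_{mw}$ be the (unique) meromorphic function on $M$ with $(f^{D_0}_{mw})+D_0+mw\ge0$ and principal part $z_w^{-m}$ at $w$. For a nilpotent $n\times n$ matrix $A$ put $f^{D_0}_{w,A}=\sum_{j=0}^{n-1}f^{D_0}_{(j+1)w}A^j$; that is, for an upper triangular nilpotent Jordan cell $A$ it is the upper triangular Toeplitz matrix with first row $f^{D_0}_w,f^{D_0}_{2w},\dots,f^{D_0}_{nw}$,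 extended to all nilpotent $A$ by similarity and direct sums. **The matrix $\Gamma^{D_0}_{\mathcal D}$.** Let $\Gamma^{D_0}_{\mathcal D}=[\Gamma_{ij}]_{i\in P,\,j\in Z}$ be the block matrix with $$\Gamma_{ij}=-\operatorname{res}_{u_j}\bigl[f^{D_0}_{u_i,A_{\pi_i}}C_{\pi_i}B_{\zeta_j}(z_jI-A_{\zeta_j})^{-1}\bigr]\quad(i\ne j),$$ $$\Gamma_{jj}=S_j-\operatorname{res}_{u_j}\bigl[\bigl(f^{D_0}_{u_j,A_{\pi_j}}-(z_jI-A_{\pi_j})^{-1}\bigr)C_{\pi_j}B_{\zeta_j}(z_jI-A_{\zeta_j})^{-1}\bigr],$$ and let $B_\zeta=\operatorname{row}_{j\in Z}[B_{\zeta_j}]$. **Proposition.** Let $\mathbf u_0\in\mathbb C^{1\times r}$, $\mathbf u_i\in\mathbb C^{1\times n_{\pi_i}}$ $(i\in P)$ and $$\mathbf k=\mathbf u_0+\sum_{i\in P}\mathbf u_i\,f^{D_0}_{u_i,A_{\pi_i}}C_{\pi_i}.$$ Then $\mathbf k\circ\rho\in\mathcal O_{\hat u_i}^{1\times r}\cdot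 F_{\mathcal D}$ for every point $u_i$ in the support of $\mathcal D$ if and only if $$\mathbf u_0B_\zeta=\operatorname{row}_{i\in P}[\mathbf u_i]\cdot\Gamma^{D_0}_{\mathcal D}.$$ -/

import Mathlib

open Filter Topology Matrix
open scoped Manifold ContDiff

noncomputable section

namespace NullPole

/-! ### Residues of functions of one complex variable -/

/-- `c` is the coefficient of `(t - a)⁻¹` in the Laurent expansion
`∑_{j=0}^{N} b_j (t - a)^{-(j+1)} + h(t)` (`h` analytic at `a`) of `g` at `a`. -/
def HasResidueAt (g : ℂ → ℂ) (a c : ℂ) : Prop :=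
  ∃ (N : ℕ) (b : ℕ → ℂ) (h : ℂ → ℂ), AnalyticAt ℂ h a ∧ b 0 = c ∧
    ∀ᶠ t in 𝓝[≠] a, g t = ∑ j ∈ Finset.range (N + 1), b j * ((t - a) ^ (j + 1))⁻¹ + h t

/-- The residue of `g` at `a` (a junk value if `g` has no finite Laurent expansion at `a`). -/
def residueAt (g : ℂ → ℂ) (a : ℂ) : ℂ := Classical.epsilon (HasResidueAt g a)

lemma laurent_coeff_eq_zero (a : ℂ) (N : ℕ) (d : ℕ → ℂ) (h : ℂ → ℂ) (hh : AnalyticAt ℂ h a)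
    (he : ∀ᶠ t in 𝓝[≠] a,
      ∑ j ∈ Finset.range (N + 1), d j * ((t - a) ^ (j + 1))⁻¹ = h t) : d 0 = 0 := by
  induction N with
  | zero =>
    have h1 : Tendsto (fun t => h t * (t - a)) (𝓝[≠] a) (𝓝 0) := by
      have : ContinuousAt (fun t => h t * (t - a)) a :=
        hh.continuousAt.mul (by fun_prop)
      have := this.tendsto
      simp only [sub_self, mul_zero] at this
      exact this.mono_left nhdsWithin_le_nhds
    have h2 : Tendsto (fun _ : ℂ => d 0) (𝓝[≠] a) (𝓝 0) := by
      refine h1.congr' ?_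
      filter_upwards [he, self_mem_nhdsWithin] with t ht hta
      have : t - a ≠ 0 := sub_ne_zero.mpr hta
      rw [← ht]; simp; field_simp
    exact tendsto_nhds_unique tendsto_const_nhds h2
  | succ N ih =>
    have key : d (N + 1) = 0 := by
      have h1 : Tendsto (fun t => h t * (t - a) ^ (N + 2) -
          ∑ j ∈ Finset.range (N + 1), d j * (t - a) ^ (N + 1 - j)) (𝓝[≠] a) (𝓝 0) := by
        have hc : ContinuousAt (fun t => h t * (t - a) ^ (N + 2) -
          ∑ j ∈ Finset.range (N + 1), d j * (t - a) ^ (N + 1 - j)) a :=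
          (hh.continuousAt.mul (by fun_prop)).sub (by fun_prop)
        have := hc.tendsto
        have hz : ∑ j ∈ Finset.range (N + 1), d j * (a - a) ^ (N + 1 - j) = 0 := by
          refine Finset.sum_eq_zero fun j hj => ?_
          have : N + 1 - j ≠ 0 := by have := Finset.mem_range.mp hj; omega
          simp [this]
        rw [hz] at this
        simp only [sub_self] at this
        simpa using this.mono_left nhdsWithin_le_nhds
      have h2 : Tendsto (fun _ : ℂ => d (N + 1)) (𝓝[≠] a) (𝓝 0) := by
        refine h1.congr' ?_
        filter_upwards [he, self_mem_nhdsWithin] with t ht hta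
        have h0 : t - a ≠ 0 := sub_ne_zero.mpr hta
        rw [← ht, Finset.sum_range_succ, add_mul, Finset.sum_mul]
        have : ∀ j ∈ Finset.range (N + 1), d j * ((t - a) ^ (j + 1))⁻¹ * (t - a) ^ (N + 2)
            = d j * (t - a) ^ (N + 1 - j) := by
          intro j hj
          have hj' : N + 2 = (j + 1) + (N + 1 - j) := by
            have := Finset.mem_range.mp hj; omega
          rw [hj', pow_add]; field_simp; ring
        rw [Finset.sum_congr rfl this]; field_simp; ring
      exact tendsto_nhds_unique tendsto_const_nhds h2
    refine ih ?_
    filter_upwards [he] with t ht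
    rw [Finset.sum_range_succ, key] at ht
    simpa using ht

lemma HasResidueAt.unique {g : ℂ → ℂ} {a c c' : ℂ} (h : HasResidueAt g a c)
    (h' : HasResidueAt g a c') : c = c' := by
  obtain ⟨N, b, h, hh, rfl, hb⟩ := h
  obtain ⟨N', b', h', hh', rfl, hb'⟩ := h'
  set D : ℕ → ℂ := fun j => (if j < N + 1 then b j else 0) - (if j < N' + 1 then b' j else 0)
  have h0 : D 0 = b 0 - b' 0 := by simp [D]
  have ext : ∀ (n m : ℕ) (e : ℕ → ℂ) (t : ℂ), n ≤ m →
      ∑ j ∈ Finset.range (m + 1), (if j < n + 1 then e j else 0) * ((t - a) ^ (j + 1))⁻¹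
        = ∑ j ∈ Finset.range (n + 1), e j * ((t - a) ^ (j + 1))⁻¹ := by
    intro n m e t hnm
    have hs : Finset.range (n + 1) ⊆ Finset.range (m + 1) := by
      intro j hj; simp only [Finset.mem_range] at *; omega
    rw [← Finset.sum_subset hs]
    · refine Finset.sum_congr rfl fun j hj => ?_
      rw [if_pos (Finset.mem_range.mp hj)]
    · intro j _ hj
      rw [if_neg (by simpa using hj)]; simp
  have := laurent_coeff_eq_zero a (max N N') D (fun t => h' t - h t) (hh'.sub hh) (by
    filter_upwards [hb, hb'] with t ht ht'
    simp only [D, sub_mul, Finset.sum_sub_distrib]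
    rw [ext N _ b t (le_max_left _ _), ext N' _ b' t (le_max_right _ _)]
    linear_combination ht' - ht)
  rw [h0] at this
  exact sub_eq_zero.mp this

lemma HasResidueAt.residueAt_eq {g : ℂ → ℂ} {a c : ℂ} (h : HasResidueAt g a c) :
    residueAt g a = c :=
  (Classical.epsilon_spec (p := HasResidueAt g a) ⟨c, h⟩).unique h

/-! ### Holomorphic and meromorphic germs and differentials on a Riemann surface -/

section Surface

variable {X : Type*} [TopologicalSpace X] [ChartedSpace ℂ X]

/-- `f` is holomorphic on a neighbourhood of `q`. -/
def HolAt (f : X → ℂ) (q : X) : Prop :=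
  AnalyticAt ℂ (f ∘ (chartAt ℂ q).symm) (chartAt ℂ q q)

/-- `f` is meromorphic on a neighbourhood of `q` (values at isolated points are irrelevant). -/
def MerAt (f : X → ℂ) (q : X) : Prop :=
  MeromorphicAt (f ∘ (chartAt ℂ q).symm) (chartAt ℂ q q)

/-- The order of the meromorphic function `f` at `q` (`⊤` if `f` vanishes near `q`). -/
def ordAt (f : X → ℂ) (q : X) : WithTop ℤ :=
  meromorphicOrderAt (f ∘ (chartAt ℂ q).symm) (chartAt ℂ q q)

variable (X) in
/-- Differential `1`-forms of type `(1,0)`: a complex linear form on every tangent space. -/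
abbrev OneForm : Type _ := (q : X) → (TangentSpace 𝓘(ℂ) q →L[ℂ] ℂ)

/-- The coefficient `a` of `η = a(t) dt` in the preferred chart `t` at `q`. -/
def OneForm.coeff (η : OneForm X) (q : X) : ℂ → ℂ := fun t =>
  η ((chartAt ℂ q).symm t) (mfderiv 𝓘(ℂ) 𝓘(ℂ) (chartAt ℂ q).symm t (1 : ℂ))

variable (X) in
/-- The space of holomorphic `1`-forms. -/
def holomorphicForms : Submodule ℂ (OneForm X) where
  carrier := {η | ∀ q, AnalyticAt ℂ (η.coeff q) (chartAt ℂ q q)}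
  add_mem' := fun ha hb q => (ha q).add (hb q)
  zero_mem' := fun _ => analyticAt_const (v := (0 : ℂ))
  smul_mem' := fun c _ ha q => (analyticAt_const (v := c)).mul (ha q)

variable (X) in
/-- The genus of a closed Riemann surface: the dimension of the space of holomorphic `1`-forms. -/
def genus : ℕ := Module.finrank ℂ (holomorphicForms X)

/-- The divisor `D` is nonspecial: `i(D) = 0`, i.e. the only meromorphic `1`-form `η`
with `(η) ≥ D` is zero (as a meromorphic form). -/
def IsNonspecial (D : X → ℤ) : Prop :=
  ∀ η : OneForm X, (∀ q, MeromorphicAt (η.coeff q) (chartAt ℂ q q) ∧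
      (D q : WithTop ℤ) ≤ meromorphicOrderAt (η.coeff q) (chartAt ℂ q q)) →
    ∀ q, ∀ᶠ x in 𝓝[≠] q, η x = 0

open Classical in
/-- The divisor `p_1 + ⋯ + p_g`. -/
def pointDivisor {g : ℕ} (p : Fin g → X) : X → ℤ := fun q => ∑ i, if p i = q then 1 else 0

open Classical in
/-- The divisor `p_1 + ⋯ + p_g - p_0`. -/
def baseDivisor {g : ℕ} (p : Fin g → X) (p₀ : X) : X → ℤ := fun q =>
  pointDivisor p q - if p₀ = q then 1 else 0

/-- `z` is a local holomorphic coordinate centered at `q`. -/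
structure IsCoordinateAt (z : OpenPartialHomeomorph X ℂ) (q : X) : Prop where
  mem_atlas : z ∈ IsManifold.maximalAtlas 𝓘(ℂ) ω X
  mem_source : q ∈ z.source
  centered : z q = 0

open Classical in
/-- `f` is the meromorphic function `f^{D₀}_{kw}`: `(f) + D₀ + k w ≥ 0` and the principal part
of `f` at `w` with respect to the local coordinate `z` at `w` is `z^{-k}`. -/
structure IsCanonicalFunction (D₀ : X → ℤ) (w : X) (z : OpenPartialHomeomorph X ℂ) (k : ℕ)
    (f : X → ℂ) : Prop where
  mer : ∀ q, MerAt f q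
  divisor : ∀ q, ((-(D₀ q + if q = w then (k : ℤ) else 0) : ℤ) : WithTop ℤ) ≤ ordAt f q
  principal : ∃ h : X → ℂ, HolAt h w ∧ ∀ᶠ q in 𝓝[≠] w, f q = (z q ^ k)⁻¹ + h q

end Surface

/-! ### The matrix functions `f^{D₀}_{w,A}` -/

section Canonical

variable {X : Type*} {ι κ : Type*} [Fintype ι] [DecidableEq ι] [Fintype κ] [DecidableEq κ]

/-- The matrix function `f_{w,A} = ∑_{j < n} f_{(j+1)w} A^j` attached to a nilpotent `n × n` matrix
`A`, where `f k` stands for `f_{kw}`. By `canonicalMatrix_jordan`, `canonicalMatrix_conj` and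
`canonicalMatrix_directSum` it is the upper triangular Toeplitz
matrix `[f_{(j-i+1)w}]_{i ≤ j}` if `A` is a Jordan cell, and it is compatible with similarity
and with direct sums. -/
def canonicalMatrix (f : ℕ → X → ℂ) (A : Matrix ι ι ℂ) (q : X) : Matrix ι ι ℂ :=
  ∑ j ∈ Finset.range (Fintype.card ι), f (j + 1) q • A ^ j

lemma jordan_pow (n j : ℕ) (a b : Fin n) :
    ((Matrix.of fun a b : Fin n => if (b : ℕ) = a + 1 then (1 : ℂ) else 0) ^ j) a b =
      if (b : ℕ) = a + j then 1 else 0 := by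
  induction j generalizing a with
  | zero => simp [Matrix.one_apply, Fin.ext_iff, eq_comm]
  | succ j ih =>
    rw [pow_succ', Matrix.mul_apply]
    simp only [ih, Matrix.of_apply, ite_mul, one_mul, zero_mul]
    by_cases h : (a : ℕ) + 1 < n
    · rw [Finset.sum_eq_single (⟨a + 1, h⟩ : Fin n)]
      · simp [add_assoc, add_comm 1 j]
      · intro c _ hc
        rw [if_neg]
        intro h'; exact hc (Fin.ext h')
      · simp
    · rw [Finset.sum_eq_zero, if_neg]
      · have := b.2; omega
      · intro c _
        rw [if_neg]
        have := c.2; omega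

lemma canonicalMatrix_jordan (f : ℕ → X → ℂ) (n : ℕ) (q : X) (a b : Fin n) :
    canonicalMatrix f (Matrix.of fun a b : Fin n => if (b : ℕ) = a + 1 then (1 : ℂ) else 0) q a b =
      if a ≤ b then f (b - a + 1) q else 0 := by
  simp only [canonicalMatrix, Matrix.sum_apply, Matrix.smul_apply, jordan_pow, smul_eq_mul,
    mul_ite, mul_one, mul_zero, Fintype.card_fin]
  split_ifs with h
  · have h' : (a : ℕ) ≤ b := h
    rw [Finset.sum_eq_single ((b : ℕ) - a)]
    · rw [if_pos (by omega)]
    · intro c _ hc; rw [if_neg (by omega)]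
    · intro hc; exact absurd (Finset.mem_range.mpr (by have := b.2; omega)) hc
  · refine Finset.sum_eq_zero fun c _ => if_neg ?_
    have : ¬ (a : ℕ) ≤ b := h
    omega

lemma canonicalMatrix_conj (f : ℕ → X → ℂ) (A T T' : Matrix ι ι ℂ) (h : T' * T = 1) (q : X) :
    canonicalMatrix f (T * A * T') q = T * canonicalMatrix f A q * T' := by
  have h' : T * T' = 1 := mul_eq_one_comm.mp h
  have hp : ∀ j : ℕ, (T * A * T') ^ j = T * A ^ j * T' := by
    intro j
    induction j with
    | zero => simp [h']
    | succ j ih =>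
      rw [pow_succ, ih, pow_succ]
      calc T * A ^ j * T' * (T * A * T') = T * A ^ j * (T' * T) * A * T' := by
            simp only [Matrix.mul_assoc]
        _ = _ := by rw [h]; simp only [Matrix.mul_assoc, Matrix.one_mul]
  simp only [canonicalMatrix, hp, Finset.mul_sum, Finset.sum_mul, Matrix.mul_smul,
    Matrix.smul_mul]

lemma pow_eq_zero_of_card_le {A : Matrix ι ι ℂ} (hA : IsNilpotent A) {j : ℕ}
    (hj : Fintype.card ι ≤ j) : A ^ j = 0 := by
  have h := Matrix.isNilpotent_charpoly_sub_pow_of_isNilpotent hA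
  have h1 : A.charpoly = Polynomial.X ^ Fintype.card ι := sub_eq_zero.mp h.eq_zero
  have h2 := Matrix.aeval_self_charpoly A
  rw [h1] at h2
  simp only [map_pow, Polynomial.aeval_X] at h2
  exact pow_eq_zero_of_le hj h2

lemma canonicalMatrix_eq_sum (f : ℕ → X → ℂ) {A : Matrix ι ι ℂ} (hA : IsNilpotent A) (q : X)
    {m : ℕ} (hm : Fintype.card ι ≤ m) :
    canonicalMatrix f A q = ∑ j ∈ Finset.range m, f (j + 1) q • A ^ j := by
  refine Finset.sum_subset (by simpa using hm) fun j _ hj => ?_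
  rw [pow_eq_zero_of_card_le hA (by simpa using hj), smul_zero]

lemma canonicalMatrix_directSum (f : ℕ → X → ℂ) {A : Matrix ι ι ℂ} {B : Matrix κ κ ℂ}
    (hA : IsNilpotent A) (hB : IsNilpotent B) (q : X) :
    canonicalMatrix f (Matrix.fromBlocks A 0 0 B) q =
      Matrix.fromBlocks (canonicalMatrix f A q) 0 0 (canonicalMatrix f B q) := by
  have hp : ∀ j : ℕ, (Matrix.fromBlocks A 0 0 B) ^ j = Matrix.fromBlocks (A ^ j) 0 0 (B ^ j) := by
    intro j
    induction j with
    | zero => simp [Matrix.fromBlocks_one]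
    | succ j ih => simp [pow_succ, ih, Matrix.fromBlocks_multiply]
  rw [canonicalMatrix_eq_sum f hA q (m := Fintype.card (ι ⊕ κ)) (by simp),
    canonicalMatrix_eq_sum f hB q (m := Fintype.card (ι ⊕ κ)) (by simp), canonicalMatrix]
  simp only [hp]
  ext (a | a) (b | b) <;> simp [Matrix.sum_apply]

end Canonical

/-! ### Null-pole divisors -/

/-- A `0`-admissible Sylvester data set `((B_ζ, A_ζ), (A_π, C_π), S)`. -/
structure SylvesterData (r : ℕ) where
  nζ : ℕ
  nπ : ℕ
  Bζ : Matrix (Fin r) (Fin nζ) ℂ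
  Aζ : Matrix (Fin nζ) (Fin nζ) ℂ
  Aπ : Matrix (Fin nπ) (Fin nπ) ℂ
  Cπ : Matrix (Fin nπ) (Fin r) ℂ
  S : Matrix (Fin nπ) (Fin nζ) ℂ
  nilpotent_π : IsNilpotent Aπ
  controllable : ⨆ j : Fin nπ, LinearMap.range (Aπ ^ (j : ℕ) * Cπ).mulVecLin = ⊤
  nilpotent_ζ : IsNilpotent Aζ
  observable : ⨅ j : Fin nζ, LinearMap.ker (Bζ * Aζ ^ (j : ℕ)).mulVecLin = ⊥
  sylvester : Aπ * S - S * Aζ = Cπ * Bζ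

section Surface

variable {X : Type*} [TopologicalSpace X] [ChartedSpace ℂ X] {r : ℕ}

/-- The entrywise residue at `q` of a matrix function `G` near `q`, with respect to the
coordinate `z` at `q`. -/
def matrixResidue {m n : Type*} (z : OpenPartialHomeomorph X ℂ) (q : X) (G : X → Matrix m n ℂ) :
    Matrix m n ℂ :=
  Matrix.of fun a b => residueAt (fun t => G (z.symm t) a b) (z q)

/-- The resolvent `(z(u) I - A)⁻¹`. -/
def resolventAt {n : ℕ} (z : OpenPartialHomeomorph X ℂ) (A : Matrix (Fin n) (Fin n) ℂ) (u : X) :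
    Matrix (Fin n) (Fin n) ℂ :=
  (z u • (1 : Matrix (Fin n) (Fin n) ℂ) - A)⁻¹

/-- The row module `𝒪_q^{1×r} · F`, as a set of germs at `q` of meromorphic row functions
(functions that agree on a punctured neighbourhood of `q` represent the same germ). -/
def rowModule (F : X → Matrix (Fin r) (Fin r) ℂ) (q : X) : Set (X → Fin r → ℂ) :=
  {k | ∃ h : X → Fin r → ℂ, (∀ a, HolAt (fun u => h u a) q) ∧
    ∀ᶠ u in 𝓝[≠] q, k u = h u ᵥ* F u}

/-- The singular subspace `𝒮(Υ, q, z)`: the germs `x (z(u) I - A_π)⁻¹ C_π + h(u)` with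
`x S = res_q [h(u) B_ζ (z(u) I - A_ζ)⁻¹]`. -/
def singularSubspace (Υ : SylvesterData r) (z : OpenPartialHomeomorph X ℂ) (q : X) :
    Set (X → Fin r → ℂ) :=
  {k | ∃ (x : Fin Υ.nπ → ℂ) (h : X → Fin r → ℂ), (∀ a, HolAt (fun u => h u a) q) ∧
    (∀ᶠ u in 𝓝[≠] q, k u = x ᵥ* (resolventAt z Υ.Aπ u * Υ.Cπ) + h u) ∧
    replicateRow Unit (x ᵥ* Υ.S) =
      matrixResidue z q fun u => replicateRow Unit (h u) * Υ.Bζ * resolventAt z Υ.Aζ u}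

variable (X r) in
/-- A right matrix null-pole divisor: an admissible Sylvester data set and a centered local
coordinate at every point, the data being trivial at all but finitely many points. -/
structure NullPoleDivisor where
  data : X → SylvesterData r
  coord : X → OpenPartialHomeomorph X ℂ
  isCoordinateAt : ∀ q, IsCoordinateAt (coord q) q
  finite_support : {q | (data q).nπ ≠ 0 ∨ (data q).nζ ≠ 0}.Finite

namespace NullPoleDivisor

variable (D : NullPoleDivisor X r)

/-- The points `u_1, …, u_k` at which the data are nontrivial. -/
def support : Set X := {q | (D.data q).nπ ≠ 0 ∨ (D.data q).nζ ≠ 0}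

/-- The index set `I ∪ II`: the points at which there is a pole. -/
def Poles : Type _ := {q : X // (D.data q).nπ ≠ 0}

/-- The index set `II ∪ III`: the points at which there is a zero. -/
def Zeros : Type _ := {q : X // (D.data q).nζ ≠ 0}

instance : Fintype D.Poles :=
  (D.finite_support.subset (t := {q | (D.data q).nπ ≠ 0}) fun _ h => Or.inl h).fintype

instance : Fintype D.Zeros :=
  (D.finite_support.subset (t := {q | (D.data q).nζ ≠ 0}) fun _ h => Or.inr h).fintype

/-- The functions of the form `u₀ + ∑_{i ∈ I ∪ II} u_i f_{u_i, A_π} C_π`, where `f w k`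
stands for `f_{kw}`. -/
def rowFunction (f : X → ℕ → X → ℂ) (u₀ : Fin r → ℂ)
    (u : (i : D.Poles) → Fin (D.data i.1).nπ → ℂ) : X → Fin r → ℂ := fun q =>
  u₀ + ∑ i : D.Poles, u i ᵥ* (canonicalMatrix (f i.1) (D.data i.1).Aπ q * (D.data i.1).Cπ)

open Classical in
/-- The block `Γ_{ij}` for the points `i` and `j`. -/
def gammaBlock (f : X → ℕ → X → ℂ) (i j : X) :
    Matrix (Fin (D.data i).nπ) (Fin (D.data j).nζ) ℂ :=
  if h : i = j then
    (D.data i).S.submatrix id (Fin.cast (by rw [h])) -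
      matrixResidue (D.coord j) j fun q =>
        (canonicalMatrix (f i) (D.data i).Aπ q - resolventAt (D.coord i) (D.data i).Aπ q) *
          (D.data i).Cπ * (D.data j).Bζ * resolventAt (D.coord j) (D.data j).Aζ q
  else
    -matrixResidue (D.coord j) j fun q =>
        canonicalMatrix (f i) (D.data i).Aπ q *
          (D.data i).Cπ * (D.data j).Bζ * resolventAt (D.coord j) (D.data j).Aζ q

/-- The block matrix `Γ`, with block rows indexed by `I ∪ II` and block columns by `II ∪ III`. -/
def gamma (f : X → ℕ → X → ℂ) :
    Matrix ((i : D.Poles) × Fin (D.data i.1).nπ) ((j : D.Zeros) × Fin (D.data j.1).nζ) ℂ :=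
  Matrix.of fun a b => D.gammaBlock f a.1.1 b.1.1 a.2 b.2

/-- The block row `B_ζ = row_{j ∈ II ∪ III} [B_{ζ_j}]`. -/
def zetaRow : Matrix (Fin r) ((j : D.Zeros) × Fin (D.data j.1).nζ) ℂ :=
  Matrix.of fun a b => (D.data b.1.1).Bζ a b.2

/-- The block row vector `row_{i ∈ I ∪ II} [u_i]`. -/
def blockRow (u : (i : D.Poles) → Fin (D.data i.1).nπ → ℂ) :
    ((i : D.Poles) × Fin (D.data i.1).nπ) → ℂ := fun a => u a.1 a.2

/-- `F` is a global matrix function `F_𝒟` attached to `𝒟` on the covering `ρ : Y → X`: on the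
preimages of the members `U` of an open covering of `X`, `F = H · (L ∘ ρ)`, where `L` is a
nondegenerate meromorphic matrix function on `U` that solves the interpolation problem
`𝒪_q^{1×r} L = 𝒮(Υ_q, q)`, `q ∈ U`, and `H` is holomorphic and invertible on `ρ⁻¹(U)`. -/
def IsTrivialization {Y : Type*} [TopologicalSpace Y] [ChartedSpace ℂ Y] (ρ : Y → X)
    (F : Y → Matrix (Fin r) (Fin r) ℂ) : Prop :=
  ∀ p : X, ∃ U : Set X, IsOpen U ∧ p ∈ U ∧
    ∃ (L : X → Matrix (Fin r) (Fin r) ℂ) (H : Y → Matrix (Fin r) (Fin r) ℂ),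
      (∀ q ∈ U, (∀ a b, MerAt (fun u => L u a b) q) ∧ (∀ᶠ u in 𝓝[≠] q, (L u).det ≠ 0) ∧
        rowModule L q = singularSubspace (D.data q) (D.coord q) q) ∧
      (∀ y ∈ ρ ⁻¹' U, (∀ a b, HolAt (fun v => H v a b) y) ∧ (H y).det ≠ 0 ∧
        ∀ᶠ v in 𝓝[≠] y, F v = H v * L (ρ v))

end NullPoleDivisor

end Surface

end NullPole

end

open NullPole

noncomputable section

namespace NullPole

/-! ### Calculus of residues -/

/-! Both sides split over the points `q` of the support, and at each point the claim is local. Near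
`s q`, `F = H · (L ∘ ρ)` with `H` holomorphic and invertible and `ρ` a local biholomorphism, so the
lifted condition on `k` says that `k` lies in the row module of `L` at `q`, that is, in the singular
subspace (`comp_mem_rowModule_iff`).

Since `D₀` vanishes at `q`, each `f_{u_i, A_π}` is a holomorphic `G_i` near `q`, plus `(z - A_π)⁻¹`
when `u_i = q` (`exists_holAt_canonicalMatrix`). Hence `k = x (z - A_π)⁻¹ C_π + h` with `h = u₀ + ∑
u_i G_i C_{π_i}`, where `x` is the vector `u_i` at `q`, or zero if `q` is not a pole.
Controllability makes this presentation unique (`mem_singularSubspace_iff`), so membership becomes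
the single equation `x S = res [h B_ζ (z - A_ζ)⁻¹]`. The resolvent has residue `1`, so the right
side is `u₀ B_ζ + ∑ u_i K_i` with `K_i` the residue of `G_i C_{π_i} B_ζ (z - A_ζ)⁻¹`. The block
`Γ_{iq}` is `S - K_i` if `u_i = q` and `-K_i` otherwise, so this is the block column of `u₀ B_ζ =
(u_i) Γ` at `q`.

Because `residueAt` is a choice, its additivity needs existence; sums are therefore computed with
the relation `HasResidueAt`. -/

lemma HasResidueAt.congr {g g' : ℂ → ℂ} {a c : ℂ} (h : HasResidueAt g a c)
    (he : ∀ᶠ t in 𝓝[≠] a, g' t = g t) : HasResidueAt g' a c := by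
  obtain ⟨N, b, h, hh, rfl, hb⟩ := h
  refine ⟨N, b, h, hh, rfl, ?_⟩
  filter_upwards [he, hb] with t ht ht'
  rw [ht, ht']

lemma residueAt_congr {g g' : ℂ → ℂ} {a : ℂ} (he : ∀ᶠ t in 𝓝[≠] a, g' t = g t) :
    residueAt g' a = residueAt g a := by
  -- Equality of the predicates, not just of their witnesses, makes the chosen values agree even
  -- when no residue exists.
  have : HasResidueAt g' a = HasResidueAt g a := by
    funext c
    refine propext ⟨fun h => h.congr ?_, fun h => h.congr he⟩
    filter_upwards [he] with t ht using ht.symm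
  rw [residueAt, residueAt, this]

lemma hasResidueAt_of_analyticAt {h : ℂ → ℂ} {a : ℂ} (hh : AnalyticAt ℂ h a) :
    HasResidueAt h a 0 :=
  ⟨0, 0, h, hh, rfl, by simp⟩

lemma hasResidueAt_pole (a : ℂ) (j : ℕ) :
    HasResidueAt (fun t => ((t - a) ^ (j + 1))⁻¹) a (if j = 0 then 1 else 0) := by
  refine ⟨j, fun i => if j = i then 1 else 0, 0, analyticAt_const, rfl, ?_⟩
  filter_upwards with t
  simp

lemma HasResidueAt.add {g g' : ℂ → ℂ} {a c c' : ℂ} (hg : HasResidueAt g a c)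
    (hg' : HasResidueAt g' a c') : HasResidueAt (fun t => g t + g' t) a (c + c') := by
  obtain ⟨N, b, h, hh, rfl, hb⟩ := hg
  obtain ⟨N', b', h', hh', rfl, hb'⟩ := hg'
  refine ⟨max N N', fun j => (if j < N + 1 then b j else 0) + (if j < N' + 1 then b' j else 0),
    fun t => h t + h' t, hh.add hh', by simp, ?_⟩
  have ext : ∀ (n m : ℕ) (e : ℕ → ℂ) (t : ℂ), n ≤ m →
      ∑ j ∈ Finset.range (m + 1), (if j < n + 1 then e j else 0) * ((t - a) ^ (j + 1))⁻¹
        = ∑ j ∈ Finset.range (n + 1), e j * ((t - a) ^ (j + 1))⁻¹ := by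
    intro n m e t hnm
    simp only [ite_mul, zero_mul]
    rw [← Finset.sum_filter]
    congr 1
    ext j
    simp only [Finset.mem_filter, Finset.mem_range]
    omega
  filter_upwards [hb, hb'] with t ht ht'
  simp only [add_mul, Finset.sum_add_distrib]
  rw [ext N _ b t (le_max_left _ _), ext N' _ b' t (le_max_right _ _), ht, ht']
  ring

lemma HasResidueAt.const_mul {g : ℂ → ℂ} {a c : ℂ} (x : ℂ) (hg : HasResidueAt g a c) :
    HasResidueAt (fun t => x * g t) a (x * c) := by
  obtain ⟨N, b, h, hh, rfl, hb⟩ := hg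
  refine ⟨N, fun j => x * b j, fun t => x * h t, analyticAt_const.mul hh, rfl, ?_⟩
  filter_upwards [hb] with t ht
  rw [ht, mul_add, Finset.mul_sum]
  simp only [mul_assoc]

lemma HasResidueAt.sum {ι : Type*} (s : Finset ι) {g : ι → ℂ → ℂ} {a : ℂ} {c : ι → ℂ}
    (hg : ∀ i ∈ s, HasResidueAt (g i) a (c i)) :
    HasResidueAt (fun t => ∑ i ∈ s, g i t) a (∑ i ∈ s, c i) := by
  classical
  induction s using Finset.induction_on with
  | empty => simpa using hasResidueAt_of_analyticAt (analyticAt_const (v := (0 : ℂ)) (x := a))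
  | insert i s hi ih =>
    simp only [Finset.sum_insert hi]
    exact (hg i (Finset.mem_insert_self _ _)).add
      (ih fun j hj => hg j (Finset.mem_insert_of_mem hj))

/-- An analytic function over a power of the coordinate has a residue. -/
lemma exists_hasResidueAt_mul_pole {h : ℂ → ℂ} {a : ℂ} (hh : AnalyticAt ℂ h a) (N : ℕ) :
    ∃ c, HasResidueAt (fun t => h t * ((t - a) ^ N)⁻¹) a c := by
  induction N generalizing h with
  | zero => exact ⟨0, by simpa using hasResidueAt_of_analyticAt hh⟩
  | succ N ih =>
    -- Write `h = h a + (t - a) h'`: the constant gives a pure pole of known residue, and the rest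
    -- has a pole bound lower by one.
    obtain ⟨h', hh', he⟩ : ∃ h' : ℂ → ℂ, AnalyticAt ℂ h' a ∧
        ∀ᶠ t in 𝓝 a, h t - h a = (t - a) * h' t := by
      have h1 : AnalyticAt ℂ (fun t => h t - h a) a := hh.sub analyticAt_const
      have h2 : ((1 : ℕ) : ℕ∞) ≤ analyticOrderAt (fun t => h t - h a) a := by
        rw [Nat.cast_one, Order.one_le_iff_ne_zero, h1.analyticOrderAt_ne_zero, sub_self]
      obtain ⟨h', hh', he⟩ := (natCast_le_analyticOrderAt h1).mp h2
      exact ⟨h', hh', by simpa using he⟩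
    obtain ⟨c, hc⟩ := ih hh'
    refine ⟨_, (((hasResidueAt_pole a N).const_mul (h a)).add hc).congr ?_⟩
    filter_upwards [he.filter_mono nhdsWithin_le_nhds, self_mem_nhdsWithin] with t ht hta
    have h0 : t - a ≠ 0 := sub_ne_zero.mpr hta
    have : h t = h a + (t - a) * h' t := by linear_combination ht
    rw [this, pow_succ]
    field_simp

/-- The coefficients of a principal part that represents an analytic function all vanish. -/
lemma laurent_coeff_eq_zero_of_le (a : ℂ) (N : ℕ) (d : ℕ → ℂ) (h : ℂ → ℂ)
    (hh : AnalyticAt ℂ h a) (he : ∀ᶠ t in 𝓝[≠] a,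
      ∑ j ∈ Finset.range (N + 1), d j * ((t - a) ^ (j + 1))⁻¹ = h t) :
    ∀ j ≤ N, d j = 0 := by
  induction N generalizing d h with
  | zero =>
    intro j hj
    rw [Nat.le_zero.mp hj]
    exact laurent_coeff_eq_zero a 0 d h hh he
  | succ N ih =>
    have h0 : d 0 = 0 := laurent_coeff_eq_zero a (N + 1) d h hh he
    -- Multiplying by `t - a` removes the vanished first coefficient and shifts the others down by
    -- one.
    have he' : ∀ᶠ t in 𝓝[≠] a, ∑ j ∈ Finset.range (N + 1),
        d (j + 1) * ((t - a) ^ (j + 1))⁻¹ = (t - a) * h t := by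
      filter_upwards [he, self_mem_nhdsWithin] with t ht hta
      have hta : t - a ≠ 0 := sub_ne_zero.mpr hta
      rw [← ht, Finset.sum_range_succ' _ (N + 1), h0, zero_mul, add_zero, Finset.mul_sum]
      refine Finset.sum_congr rfl fun j _ => ?_
      rw [pow_succ _ (j + 1)]
      field_simp
    have hh' : AnalyticAt ℂ (fun t => (t - a) * h t) a :=
      (analyticAt_id.sub analyticAt_const).mul hh
    intro j hj
    cases j with
    | zero => exact h0
    | succ j => exact ih (fun j => d (j + 1)) _ hh' he' j (by omega)

/-! ### The resolvent of a nilpotent matrix -/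

/-- The Neumann series stops at `n` terms because a nilpotent `n × n` matrix satisfies `A ^ n = 0`.
It turns resolvents into explicit principal parts. -/
lemma inv_smul_one_sub {n : ℕ} {A : Matrix (Fin n) (Fin n) ℂ} (hA : IsNilpotent A) {t : ℂ}
    (ht : t ≠ 0) : (t • (1 : Matrix (Fin n) (Fin n) ℂ) - A)⁻¹ =
      ∑ j ∈ Finset.range n, (t ^ (j + 1))⁻¹ • A ^ j := by
  refine Matrix.inv_eq_right_inv ?_
  have key : ∀ m : ℕ, (t • (1 : Matrix (Fin n) (Fin n) ℂ) - A) *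
      ∑ j ∈ Finset.range m, (t ^ (j + 1))⁻¹ • A ^ j = 1 - (t ^ m)⁻¹ • A ^ m := by
    intro m
    induction m with
    | zero => simp
    | succ m ih =>
      rw [Finset.sum_range_succ, mul_add, ih, sub_mul, smul_mul_smul_comm, one_mul,
        mul_smul_comm, ← pow_succ', pow_succ t m, mul_inv]
      rw [show t * ((t ^ m)⁻¹ * t⁻¹) = (t ^ m)⁻¹ by field_simp]
      abel
  rw [key, pow_eq_zero_of_card_le hA (by simp), smul_zero, sub_zero]

/-- If `x (t - A)⁻¹ C` is analytic at `0` and `(A, C)` is controllable, then `x = 0`. -/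
lemma eq_zero_of_vecMul_resolvent_analyticAt {n r : ℕ} {A : Matrix (Fin n) (Fin n) ℂ}
    {C : Matrix (Fin n) (Fin r) ℂ} (hA : IsNilpotent A)
    (hC : ⨆ j : Fin n, LinearMap.range (A ^ (j : ℕ) * C).mulVecLin = ⊤)
    (x : Fin n → ℂ) (h : ℂ → Fin r → ℂ) (hh : ∀ b, AnalyticAt ℂ (fun t => h t b) 0)
    (he : ∀ᶠ t in 𝓝[≠] (0 : ℂ),
      x ᵥ* ((t • (1 : Matrix (Fin n) (Fin n) ℂ) - A)⁻¹ * C) = h t) : x = 0 := by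
  -- By the Neumann series, `x A ^ j C` is the coefficient of `t^{-(j+1)}` in `x (t - A)⁻¹ C`.
  have hx : ∀ j < n, x ᵥ* (A ^ j * C) = 0 := by
    intro j hj
    obtain ⟨n, rfl⟩ : ∃ m, n = m + 1 := ⟨n - 1, by omega⟩
    funext b
    refine laurent_coeff_eq_zero_of_le 0 n (fun j => (x ᵥ* (A ^ j * C)) b) _ (hh b) ?_ j (by omega)
    filter_upwards [he, self_mem_nhdsWithin] with t ht ht0
    rw [← ht, inv_smul_one_sub hA ht0, Matrix.sum_mul, Matrix.vecMul_sum, Finset.sum_apply]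
    refine Finset.sum_congr rfl fun j _ => ?_
    rw [Matrix.smul_mul, Matrix.vecMul_smul, Pi.smul_apply, smul_eq_mul, sub_zero, mul_comm]
  -- Now `x` annihilates the range of every `A ^ j C`, hence by controllability the whole space.
  have hle : (⊤ : Submodule ℂ (Fin n → ℂ)) ≤ LinearMap.ker (dotProductBilin ℂ ℂ x) := by
    rw [← hC]
    refine iSup_le fun j => ?_
    rintro _ ⟨v, rfl⟩
    have := hx j j.2
    simp [Matrix.dotProduct_mulVec, this]
  refine dotProduct_eq_zero x fun v => ?_
  exact hle (Submodule.mem_top (x := v))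

/-! ### Holomorphic germs and local coordinates -/

/-- A left inverse near `y` prevents nearby points other than `y` from reaching `φ y`. This lets
identities valid only off the centre be carried along charts, along `ρ` and along its local inverse.
-/
lemma tendsto_punctured_of_leftInverse {Y Z : Type*} [TopologicalSpace Y] [TopologicalSpace Z]
    {φ : Y → Z} {ψ : Z → Y} {y : Y} (hφ : ContinuousAt φ y) (h : ∀ᶠ v in 𝓝 y, ψ (φ v) = v) :
    Tendsto φ (𝓝[≠] y) (𝓝[≠] (φ y)) := by
  refine tendsto_nhdsWithin_iff.mpr ⟨hφ.tendsto.mono_left nhdsWithin_le_nhds, ?_⟩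
  filter_upwards [h.filter_mono nhdsWithin_le_nhds, self_mem_nhdsWithin] with v hv hvy e
  refine hvy ?_
  have e : φ v = φ y := e
  rw [Set.mem_singleton_iff, ← hv, e, h.self_of_nhds]

lemma tendsto_punctured_of_mem_source {Y : Type*} [TopologicalSpace Y] {q : Y}
    {z : OpenPartialHomeomorph Y ℂ}
    (hq : q ∈ z.source) : Tendsto z (𝓝[≠] q) (𝓝[≠] (z q)) :=
  tendsto_punctured_of_leftInverse (z.continuousAt hq) (z.eventually_left_inverse hq)

lemma tendsto_symm_punctured_of_mem_source {Y : Type*} [TopologicalSpace Y] {q : Y}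
    {z : OpenPartialHomeomorph Y ℂ}
    (hq : q ∈ z.source) : Tendsto z.symm (𝓝[≠] (z q)) (𝓝[≠] q) := by
  have h := tendsto_punctured_of_leftInverse (z.continuousAt_symm (z.map_source hq))
    (z.eventually_right_inverse (z.map_source hq))
  rwa [z.left_inv hq] at h

section Germs

variable {X : Type*} [TopologicalSpace X] [ChartedSpace ℂ X]

lemma holAt_const (c : ℂ) (q : X) : HolAt (fun _ : X => c) q :=
  analyticAt_const (v := c)

lemma HolAt.add {f f' : X → ℂ} {q : X} (hf : HolAt f q) (hf' : HolAt f' q) :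
    HolAt (fun u => f u + f' u) q :=
  AnalyticAt.add hf hf'

lemma HolAt.mul {f f' : X → ℂ} {q : X} (hf : HolAt f q) (hf' : HolAt f' q) :
    HolAt (fun u => f u * f' u) q :=
  AnalyticAt.mul hf hf'

lemma HolAt.sum {ι : Type*} (s : Finset ι) {f : ι → X → ℂ} {q : X}
    (hf : ∀ i ∈ s, HolAt (f i) q) : HolAt (fun u => ∑ i ∈ s, f i u) q :=
  Finset.analyticAt_fun_sum s hf

lemma HolAt.prod {ι : Type*} (s : Finset ι) {f : ι → X → ℂ} {q : X}
    (hf : ∀ i ∈ s, HolAt (f i) q) : HolAt (fun u => ∏ i ∈ s, f i u) q :=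
  Finset.analyticAt_fun_prod s hf

lemma HolAt.inv {f : X → ℂ} {q : X} (hf : HolAt f q) (h : f q ≠ 0) :
    HolAt (fun u => (f u)⁻¹) q :=
  AnalyticAt.inv hf (by simpa using h)

lemma HolAt.det {r : ℕ} {H : X → Matrix (Fin r) (Fin r) ℂ} {q : X}
    (hH : ∀ a b, HolAt (fun u => H u a b) q) : HolAt (fun u => (H u).det) q := by
  simp only [Matrix.det_apply']
  exact HolAt.sum _ fun σ _ => (holAt_const _ q).mul (HolAt.prod _ fun i _ => hH _ _)

/-- Cramer's rule: the entries of the adjugate are again determinants with holomorphic entries. -/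
lemma HolAt.matrix_inv {r : ℕ} {H : X → Matrix (Fin r) (Fin r) ℂ} {q : X}
    (hH : ∀ a b, HolAt (fun u => H u a b) q) (h : (H q).det ≠ 0) (a b : Fin r) :
    HolAt (fun u => (H u)⁻¹ a b) q := by
  simp only [Matrix.inv_def, Matrix.smul_apply, Ring.inverse_eq_inv', smul_eq_mul,
    Matrix.adjugate_apply]
  refine ((HolAt.det hH).inv h).mul (HolAt.det fun i j => ?_)
  by_cases hi : i = b
  · simpa [Matrix.updateRow_apply, hi] using holAt_const _ q
  · simpa [Matrix.updateRow_apply, hi] using hH i j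

lemma HolAt.vecMul {m n : Type*} [Fintype m] {h : X → m → ℂ} {H : X → Matrix m n ℂ} {q : X}
    (hh : ∀ a, HolAt (fun u => h u a) q) (hH : ∀ a b, HolAt (fun u => H u a b) q) (b : n) :
    HolAt (fun u => (h u ᵥ* H u) b) q :=
  HolAt.sum _ fun i _ => (hh i).mul (hH i b)

lemma HolAt.mul_const {l m n : Type*} [Fintype m] {H : X → Matrix l m ℂ} {q : X}
    (hH : ∀ a b, HolAt (fun u => H u a b) q) (B : Matrix m n ℂ) (a : l) (b : n) :
    HolAt (fun u => (H u * B) a b) q := by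
  simp only [Matrix.mul_apply]
  exact HolAt.sum _ fun i _ => (hH a i).mul (holAt_const _ q)

/-- Over `ℂ`, class `ω` means analytic. This gives access to composition with smooth maps and to
invariance under change of chart. -/
lemma holAt_iff_contMDiffAt {f : X → ℂ} {q : X} :
    HolAt f q ↔ ContMDiffAt 𝓘(ℂ) 𝓘(ℂ) ω f q := by
  rw [contMDiffAt_iff]
  simp only [mfld_simps, contDiffWithinAt_univ]
  rw [← contDiffWithinAt_univ, contDiffWithinAt_omega_iff_analyticWithinAt, analyticWithinAt_univ,
    chartAt_self_eq]
  simp only [mfld_simps]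
  refine ⟨fun h => ⟨?_, h⟩, fun h => h.2⟩
  -- `ContMDiffAt` also asks for continuity of `f` itself, which is recovered by composing the chart
  -- expression with the chart.
  have h1 : ContinuousAt ((f ∘ (chartAt ℂ q).symm) ∘ chartAt ℂ q) q :=
    ContinuousAt.comp h.continuousAt ((chartAt ℂ q).continuousAt (mem_chart_source ℂ q))
  refine h1.congr ?_
  filter_upwards [(chartAt ℂ q).open_source.mem_nhds (mem_chart_source ℂ q)] with u hu
  simp [(chartAt ℂ q).left_inv hu]

/-- `HolAt` refers to the preferred chart, while residues are taken in the coordinate of the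
divisor; this passes between them. -/
lemma holAt_iff_of_mem_maximalAtlas [IsManifold 𝓘(ℂ) ω X] {f : X → ℂ} {q : X}
    {z : OpenPartialHomeomorph X ℂ} (hz : z ∈ IsManifold.maximalAtlas 𝓘(ℂ) ω X)
    (hq : q ∈ z.source) : HolAt f q ↔ AnalyticAt ℂ (f ∘ z.symm) (z q) := by
  rw [holAt_iff_contMDiffAt, contMDiffAt_iff_of_mem_maximalAtlas hz
    (IsManifold.chart_mem_maximalAtlas (f q)) hq (mem_chart_source ℂ (f q))]
  simp only [mfld_simps, contDiffWithinAt_univ]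
  rw [← contDiffWithinAt_univ, contDiffWithinAt_omega_iff_analyticWithinAt, analyticWithinAt_univ,
    chartAt_self_eq]
  simp only [mfld_simps]
  refine ⟨fun h => h.2, fun h => ⟨?_, h⟩⟩
  have h1 : ContinuousAt ((f ∘ z.symm) ∘ z) q :=
    ContinuousAt.comp h.continuousAt (z.continuousAt hq)
  refine h1.congr ?_
  filter_upwards [z.open_source.mem_nhds hq] with u hu
  simp [z.left_inv hu]

/-- A meromorphic germ of nonnegative order is holomorphic off the centre. -/
lemma exists_holAt_of_ordAt_nonneg {f : X → ℂ} {q : X} (hf : MerAt f q) (h : 0 ≤ ordAt f q) :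
    ∃ g : X → ℂ, HolAt g q ∧ ∀ᶠ u in 𝓝[≠] q, f u = g u := by
  have ha := (MeromorphicAt.meromorphicOrderAt_nonneg_iff_analyticAt_toMeromorphicNFAt hf).mp h
  refine ⟨toMeromorphicNFAt (f ∘ (chartAt ℂ q).symm) (chartAt ℂ q q) ∘ chartAt ℂ q, ?_, ?_⟩
  · refine ha.congr ?_
    filter_upwards [(chartAt ℂ q).eventually_right_inverse (mem_chart_target ℂ q)] with t ht
    simp [ht]
  · have he := (tendsto_punctured_of_mem_source (mem_chart_source ℂ q)).eventually
      (MeromorphicAt.eq_nhdsNE_toMeromorphicNFAt hf)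
    filter_upwards [he, ((chartAt ℂ q).eventually_left_inverse
      (mem_chart_source ℂ q)).filter_mono nhdsWithin_le_nhds] with u hu hu'
    rw [Function.comp_apply, ← hu, Function.comp_apply, hu']

lemma HolAt.comp_contMDiffAt {Y : Type*} [TopologicalSpace Y] [ChartedSpace ℂ Y] {f : X → ℂ}
    {φ : Y → X} {y : Y} (hf : HolAt f (φ y)) (hφ : ContMDiffAt 𝓘(ℂ) 𝓘(ℂ) ω φ y) :
    HolAt (fun v => f (φ v)) y :=
  holAt_iff_contMDiffAt.mpr (ContMDiffAt.comp y (holAt_iff_contMDiffAt.mp hf) hφ)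

/-- Membership in the row module of `H · (L ∘ ρ)` is tested on the base. -/
lemma comp_mem_rowModule_iff {Y : Type*} [TopologicalSpace Y] [ChartedSpace ℂ Y] {r : ℕ}
    {ρ : Y → X} {y : Y} (hρ : IsLocalDiffeomorphAt 𝓘(ℂ) 𝓘(ℂ) ω ρ y)
    {F H : Y → Matrix (Fin r) (Fin r) ℂ} {L : X → Matrix (Fin r) (Fin r) ℂ}
    (hH : ∀ a b, HolAt (fun v => H v a b) y) (hdet : (H y).det ≠ 0)
    (hF : ∀ᶠ v in 𝓝[≠] y, F v = H v * L (ρ v)) (k : X → Fin r → ℂ) :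
    k ∘ ρ ∈ rowModule F y ↔ k ∈ rowModule L (ρ y) := by
  have hleft := hρ.localInverse_eventuallyEq_left
  have hright := hρ.localInverse_eventuallyEq_right
  have hσy : hρ.localInverse (ρ y) = y := hleft.self_of_nhds
  have hρc := hρ.contMDiffAt
  have hσc := hρ.localInverse_contMDiffAt
  have hρt : Tendsto ρ (𝓝[≠] y) (𝓝[≠] (ρ y)) :=
    tendsto_punctured_of_leftInverse hρc.continuousAt hleft
  have hσt : Tendsto hρ.localInverse (𝓝[≠] (ρ y)) (𝓝[≠] y) := by
    have h := tendsto_punctured_of_leftInverse (ψ := ρ) hσc.continuousAt hright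
    rwa [hσy] at h
  constructor
  · rintro ⟨h, hh, he⟩
    -- Pull `k ∘ ρ = h F = (h H) (L ∘ ρ)` back along the local inverse of `ρ`.
    refine ⟨fun u => h (hρ.localInverse u) ᵥ* H (hρ.localInverse u), fun b => ?_, ?_⟩
    · have := HolAt.vecMul hh hH b
      rw [← hσy] at this
      exact this.comp_contMDiffAt hσc
    · filter_upwards [hσt.eventually he, hσt.eventually hF,
        hright.filter_mono nhdsWithin_le_nhds] with u h1 h2 h3
      have h3 : ρ (hρ.localInverse u) = u := h3
      rw [Function.comp_apply, h2, h3] at h1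
      rw [h1, Matrix.vecMul_vecMul]
  · rintro ⟨h, hh, he⟩
    refine ⟨fun v => h (ρ v) ᵥ* (H v)⁻¹, HolAt.vecMul (fun a => (hh a).comp_contMDiffAt hρc)
      (HolAt.matrix_inv hH hdet), ?_⟩
    have hne : ∀ᶠ v in 𝓝 y, (H v).det ≠ 0 :=
      (holAt_iff_contMDiffAt.mp (HolAt.det hH)).continuousAt.eventually_ne hdet
    filter_upwards [hρt.eventually he, hF, hne.filter_mono nhdsWithin_le_nhds] with v h1 h2 h3
    rw [Function.comp_apply, h1, h2, Matrix.vecMul_vecMul, ← Matrix.mul_assoc,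
      Matrix.nonsing_inv_mul _ (Ne.isUnit h3), Matrix.one_mul]

end Germs

/-! ### Residues of matrix functions on a Riemann surface -/

section Residue

variable {X : Type*} [TopologicalSpace X] {m n p : Type*}

lemma matrixResidue_congr {q : X} {z : OpenPartialHomeomorph X ℂ} (hq : q ∈ z.source)
    {G G' : X → Matrix m n ℂ} (h : ∀ᶠ u in 𝓝[≠] q, G u = G' u) :
    matrixResidue z q G = matrixResidue z q G' := by
  ext a b
  refine residueAt_congr ?_
  filter_upwards [(tendsto_symm_punctured_of_mem_source hq).eventually h] with t ht
  rw [ht]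

/-- The matrix function `G` has the entrywise residue `R` at `q` in the coordinate `z`. -/
def HasMatrixResidue (z : OpenPartialHomeomorph X ℂ) (q : X) (G : X → Matrix m n ℂ)
    (R : Matrix m n ℂ) : Prop :=
  ∀ a b, HasResidueAt (fun t => G (z.symm t) a b) (z q) (R a b)

lemma HasMatrixResidue.eq {q : X} {z : OpenPartialHomeomorph X ℂ} {G : X → Matrix m n ℂ}
    {R : Matrix m n ℂ} (h : HasMatrixResidue z q G R) : matrixResidue z q G = R := by
  ext a b
  exact (h a b).residueAt_eq

lemma HasMatrixResidue.add {q : X} {z : OpenPartialHomeomorph X ℂ} {G G' : X → Matrix m n ℂ}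
    {R R' : Matrix m n ℂ} (h : HasMatrixResidue z q G R) (h' : HasMatrixResidue z q G' R') :
    HasMatrixResidue z q (fun u => G u + G' u) (R + R') :=
  fun a b => (h a b).add (h' a b)

lemma HasMatrixResidue.const_mul [Fintype m] {q : X} {z : OpenPartialHomeomorph X ℂ}
    {G : X → Matrix m n ℂ} {R : Matrix m n ℂ} (B : Matrix p m ℂ)
    (h : HasMatrixResidue z q G R) : HasMatrixResidue z q (fun u => B * G u) (B * R) :=
  fun a b => HasResidueAt.sum Finset.univ fun i _ => (h i b).const_mul (B a i)

lemma HasMatrixResidue.sum {ι : Type*} (s : Finset ι) {q : X} {z : OpenPartialHomeomorph X ℂ}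
    {G : ι → X → Matrix m n ℂ} {R : ι → Matrix m n ℂ}
    (h : ∀ i ∈ s, HasMatrixResidue z q (G i) (R i)) :
    HasMatrixResidue z q (fun u => ∑ i ∈ s, G i u) (∑ i ∈ s, R i) := by
  intro a b
  simp only [Matrix.sum_apply]
  exact HasResidueAt.sum s fun i hi => h i hi a b

lemma eventually_resolventAt_symm {q : X} {z : OpenPartialHomeomorph X ℂ} (hq : q ∈ z.source)
    (hz : z q = 0) {n : ℕ} {A : Matrix (Fin n) (Fin n) ℂ} (hA : IsNilpotent A) :
    ∀ᶠ t in 𝓝[≠] (z q), resolventAt z A (z.symm t) =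
      ∑ j ∈ Finset.range n, ((t - z q) ^ (j + 1))⁻¹ • A ^ j := by
  filter_upwards [(z.eventually_right_inverse (z.map_source hq)).filter_mono nhdsWithin_le_nhds,
    self_mem_nhdsWithin] with t ht ht0
  have ht0 : t ≠ 0 := fun h => ht0 (by rw [h, hz]; rfl)
  rw [resolventAt, ht, inv_smul_one_sub hA ht0, hz, sub_zero]

/-- Only the term `A ^ 0` of the Neumann series is a simple pole. -/
lemma hasMatrixResidue_resolventAt {q : X} {z : OpenPartialHomeomorph X ℂ} (hq : q ∈ z.source)
    (hz : z q = 0) {n : ℕ} {A : Matrix (Fin n) (Fin n) ℂ} (hA : IsNilpotent A) :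
    HasMatrixResidue z q (fun u => resolventAt z A u) 1 := by
  intro a b
  have hs := HasResidueAt.sum (Finset.range n) fun j _ =>
    (hasResidueAt_pole (z q) j).const_mul ((A ^ j) a b)
  have h1 : ∑ j ∈ Finset.range n, (A ^ j) a b * (if j = 0 then 1 else 0) =
      (1 : Matrix (Fin n) (Fin n) ℂ) a b := by
    rw [Finset.sum_eq_single 0]
    · simp
    · intro j _ hj
      simp [hj]
    -- The term `j = 0` is missing only for `n = 0`, when there are no entries to check.
    · intro h0
      have : n = 0 := by simpa using h0
      exact absurd a.2 (by omega)
  rw [h1] at hs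
  refine hs.congr ?_
  filter_upwards [eventually_resolventAt_symm hq hz hA] with t ht
  rw [ht, Matrix.sum_apply]
  exact Finset.sum_congr rfl fun j _ => by rw [Matrix.smul_apply, smul_eq_mul, mul_comm]

/-- Each entry is a finite sum of holomorphic functions over powers of the coordinate. Existence
suffices: the values enter both `Γ` and the interpolation condition and need not be computed. -/
lemma exists_hasMatrixResidue_mul_resolventAt [ChartedSpace ℂ X] [IsManifold 𝓘(ℂ) ω X] {q : X}
    {z : OpenPartialHomeomorph X ℂ} (hz : IsCoordinateAt z q) {n : ℕ}
    {A : Matrix (Fin n) (Fin n) ℂ} (hA : IsNilpotent A) {G : X → Matrix m (Fin n) ℂ}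
    (hG : ∀ a b, HolAt (fun u => G u a b) q) :
    ∃ R, HasMatrixResidue z q (fun u => G u * resolventAt z A u) R := by
  suffices h : ∀ a b, ∃ c,
      HasResidueAt (fun t => (G (z.symm t) * resolventAt z A (z.symm t)) a b) (z q) c by
    choose R hR using h
    exact ⟨Matrix.of R, hR⟩
  intro a b
  have hG' : ∀ i, AnalyticAt ℂ (fun t => G (z.symm t) a i) (z q) := fun i =>
    (holAt_iff_of_mem_maximalAtlas hz.mem_atlas hz.mem_source).mp (hG a i)
  choose c hc using fun (i : Fin n) (j : ℕ) => exists_hasResidueAt_mul_pole (hG' i) (j + 1)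
  refine ⟨_, (HasResidueAt.sum Finset.univ fun i _ => HasResidueAt.sum (Finset.range n)
    fun j _ => (hc i j).const_mul ((A ^ j) i b)).congr ?_⟩
  filter_upwards [eventually_resolventAt_symm hz.mem_source hz.centered hA] with t ht
  rw [ht, Matrix.mul_apply]
  refine Finset.sum_congr rfl fun i _ => ?_
  rw [Matrix.sum_apply, Finset.mul_sum]
  refine Finset.sum_congr rfl fun j _ => ?_
  rw [Matrix.smul_apply, smul_eq_mul]
  ring

end Residue

/-! ### The local interpolation condition -/

section Interpolation

variable {X : Type*} [TopologicalSpace X] [ChartedSpace ℂ X] {r : ℕ}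

/-- By controllability, the vector `x` in the description of the singular subspace is determined
by the germ. -/
lemma mem_singularSubspace_iff [IsManifold 𝓘(ℂ) ω X] (Υ : SylvesterData r) {z : OpenPartialHomeomorph X ℂ} {q : X}
    (hz : IsCoordinateAt z q) {k h : X → Fin r → ℂ} (x : Fin Υ.nπ → ℂ)
    (hh : ∀ a, HolAt (fun u => h u a) q)
    (hk : ∀ᶠ u in 𝓝[≠] q, k u = x ᵥ* (resolventAt z Υ.Aπ u * Υ.Cπ) + h u) :
    k ∈ singularSubspace Υ z q ↔ replicateRow Unit (x ᵥ* Υ.S) =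
      matrixResidue z q fun u => replicateRow Unit (h u) * Υ.Bζ * resolventAt z Υ.Aζ u := by
  refine ⟨?_, fun hS => ⟨x, h, hh, hk, hS⟩⟩
  rintro ⟨x', h', hh', hk', hS⟩
  -- Subtracting two presentations of `k` shows `(x' - x) (z - A_π)⁻¹ C_π = h - h'`, which is
  -- holomorphic.
  have hx : x' - x = 0 := by
    refine eq_zero_of_vecMul_resolvent_analyticAt Υ.nilpotent_π Υ.controllable (x' - x)
      (fun t b => h (z.symm t) b - h' (z.symm t) b) (fun b => ?_) ?_
    · have h1 := (holAt_iff_of_mem_maximalAtlas hz.mem_atlas hz.mem_source).mp (hh b)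
      have h2 := (holAt_iff_of_mem_maximalAtlas hz.mem_atlas hz.mem_source).mp (hh' b)
      rw [hz.centered] at h1 h2
      exact h1.sub h2
    · have ht := tendsto_symm_punctured_of_mem_source hz.mem_source
      have hr := (z.eventually_right_inverse (z.map_source hz.mem_source)).filter_mono
        (nhdsWithin_le_nhds (s := {z q}ᶜ))
      rw [hz.centered] at ht hr
      filter_upwards [ht.eventually hk, ht.eventually hk', hr] with t h1 h2 h3
      rw [h1, resolventAt, h3] at h2
      funext b
      have h2 := congrFun h2 b
      simp only [Pi.add_apply] at h2
      rw [Matrix.sub_vecMul, Pi.sub_apply]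
      linear_combination -h2
  obtain rfl : x' = x := sub_eq_zero.mp hx
  rw [hS]
  refine matrixResidue_congr hz.mem_source ?_
  filter_upwards [hk, hk'] with u h1 h2
  rw [h1] at h2
  rw [add_left_cancel h2]

open Classical in
/-- The matrix function `f_{w,A}` minus its principal part `(z - A)⁻¹` at `w` is holomorphic at
every point outside `D₀`. -/
lemma exists_holAt_canonicalMatrix {D₀ : X → ℤ} {w q : X} {z : OpenPartialHomeomorph X ℂ}
    (hz : IsCoordinateAt z w) {f : ℕ → X → ℂ}
    (hf : ∀ k, 1 ≤ k → IsCanonicalFunction D₀ w z k (f k)) (hq : D₀ q = 0) {n : ℕ}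
    {A : Matrix (Fin n) (Fin n) ℂ} (hA : IsNilpotent A) :
    ∃ G : X → Matrix (Fin n) (Fin n) ℂ, (∀ a b, HolAt (fun u => G u a b) q) ∧
      ∀ᶠ u in 𝓝[≠] q,
        canonicalMatrix f A u = (if w = q then resolventAt z A u else 0) + G u := by
  -- At `w` the prescribed principal part gives the splitting; at any other `q` with `D₀ q = 0` the
  -- divisor condition says that the order is nonnegative.
  have key : ∀ j : ℕ, ∃ h : X → ℂ, HolAt h q ∧ ∀ᶠ u in 𝓝[≠] q,
      f (j + 1) u = (if w = q then (z u ^ (j + 1))⁻¹ else 0) + h u := by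
    intro j
    have hj := hf (j + 1) (by omega)
    by_cases hwq : w = q
    · subst hwq
      simpa using hj.principal
    · have ho := hj.divisor q
      rw [hq, if_neg (Ne.symm hwq)] at ho
      simpa [hwq] using exists_holAt_of_ordAt_nonneg (hj.mer q) (by simpa using ho)
  choose h hh he using key
  refine ⟨fun u => ∑ j ∈ Finset.range n, h j u • A ^ j, fun a b => ?_, ?_⟩
  · simp only [Matrix.sum_apply, Matrix.smul_apply, smul_eq_mul]
    exact HolAt.sum _ fun j _ => (hh j).mul (holAt_const _ q)
  · have he' : ∀ᶠ u in 𝓝[≠] q, ∀ j ∈ Finset.range n,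
        f (j + 1) u = (if w = q then (z u ^ (j + 1))⁻¹ else 0) + h j u :=
      (Finset.eventually_all _).mpr fun j _ => he j
    by_cases hwq : w = q
    · subst hwq
      simp only [if_true] at he' ⊢
      filter_upwards [he', (tendsto_punctured_of_mem_source hz.mem_source).eventually
        self_mem_nhdsWithin] with u hu hu0
      have hu0 : z u ≠ 0 := fun e => hu0 (by rw [e, hz.centered]; rfl)
      rw [resolventAt, inv_smul_one_sub hA hu0, ← Finset.sum_add_distrib, canonicalMatrix,
        Fintype.card_fin]
      exact Finset.sum_congr rfl fun j hj => by rw [hu j hj, add_smul]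
    · simp only [if_neg hwq, zero_add] at he' ⊢
      filter_upwards [he'] with u hu
      rw [canonicalMatrix, Fintype.card_fin]
      exact Finset.sum_congr rfl fun j hj => by rw [hu j hj]

end Interpolation

/-! ### The interpolation condition in terms of `Γ` -/

lemma baseDivisor_eq_zero {X : Type*} {g : ℕ} {p : Fin g → X} {p₀ q : X} (h₀ : p₀ ≠ q)
    (h : ∀ i, p i ≠ q) : baseDivisor p p₀ q = 0 := by
  simp [baseDivisor, pointDivisor, h₀, h]

namespace NullPoleDivisor

variable {X : Type*} [TopologicalSpace X] [ChartedSpace ℂ X] {r : ℕ} (D : NullPoleDivisor X r)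

open Classical in
/-- The component at the point `q` of a family of row vectors indexed by the poles. -/
def component (u : (i : D.Poles) → Fin (D.data i.1).nπ → ℂ) (q : X) : Fin (D.data q).nπ → ℂ :=
  if h : (D.data q).nπ ≠ 0 then u ⟨q, h⟩ else 0

-- At most one pole equals `q`. Letting `Φ` range over all points avoids transporting `u i` along `i
-- = q`; if `q` is not a pole, the sum is empty and `hΦ` makes the right side zero too.
open Classical in
lemma sum_poles_eq {V : Type*} [AddCommMonoid V] (u : (i : D.Poles) → Fin (D.data i.1).nπ → ℂ)
    (q : X) (Φ : (i : X) → (Fin (D.data i).nπ → ℂ) → V) (hΦ : Φ q 0 = 0) :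
    ∑ i : D.Poles, (if i.1 = q then Φ i.1 (u i) else 0) = Φ q (D.component u q) := by
  by_cases h : (D.data q).nπ ≠ 0
  · rw [component, dif_pos h]
    refine (Finset.sum_eq_single (ι := D.Poles) ⟨q, h⟩ (fun i _ hi => ?_) fun h' => ?_).trans
      (if_pos rfl)
    · exact if_neg fun e => hi (Subtype.ext e)
    · exact absurd (Finset.mem_univ _) h'
  · rw [component, dif_neg h, hΦ]
    refine Finset.sum_eq_zero fun i _ => if_neg fun e => ?_
    exact h (by rw [← e]; exact i.2)

open Classical in
/-- The block `Γ_{iq}` in terms of the residue of the holomorphic part of `f_{u_i, A_π}` at `q`. -/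
lemma gammaBlock_eq {f : X → ℕ → X → ℂ} {i q : X}
    {G : X → Matrix (Fin (D.data i).nπ) (Fin (D.data i).nπ) ℂ}
    (hG : ∀ᶠ v in 𝓝[≠] q, canonicalMatrix (f i) (D.data i).Aπ v =
      (if i = q then resolventAt (D.coord i) (D.data i).Aπ v else 0) + G v) :
    D.gammaBlock f i q =
      (if h : i = q then (D.data i).S.submatrix id (Fin.cast (by rw [h])) else 0) -
      matrixResidue (D.coord q) q fun v =>
        G v * (D.data i).Cπ * (D.data q).Bζ * resolventAt (D.coord q) (D.data q).Aζ v := by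
  by_cases h : i = q
  · rw [gammaBlock, dif_pos h, dif_pos h]
    refine congrArg (_ - ·) (matrixResidue_congr (D.isCoordinateAt q).mem_source ?_)
    filter_upwards [hG] with v hv
    rw [hv, if_pos h, add_sub_cancel_left]
  · rw [gammaBlock, dif_neg h, dif_neg h, zero_sub]
    refine congrArg (- ·) (matrixResidue_congr (D.isCoordinateAt q).mem_source ?_)
    filter_upwards [hG] with v hv
    rw [hv, if_neg h, zero_add]

/-- The interpolation condition at the point `q` for a row function
`u₀ + ∑ u_i f_{u_i, A_π} C_π`. -/
lemma rowFunction_mem_singularSubspace_iff [IsManifold 𝓘(ℂ) ω X] {D₀ : X → ℤ}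
    {f : X → ℕ → X → ℂ} (hf : ∀ w, (D.data w).nπ ≠ 0 → ∀ k, 1 ≤ k →
      IsCanonicalFunction D₀ w (D.coord w) k (f w k))
    (u₀ : Fin r → ℂ) (u : (i : D.Poles) → Fin (D.data i.1).nπ → ℂ) {q : X} (hq : D₀ q = 0) :
    D.rowFunction f u₀ u ∈ singularSubspace (D.data q) (D.coord q) q ↔
      u₀ ᵥ* (D.data q).Bζ = ∑ i : D.Poles, u i ᵥ* D.gammaBlock f i.1 q := by
  classical
  have hz := D.isCoordinateAt q
  choose G hG hGe using fun i : D.Poles => exists_holAt_canonicalMatrix (D.isCoordinateAt i.1)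
    (hf i.1 i.2) hq (D.data i.1).nilpotent_π
  choose K hK using fun i : D.Poles => exists_hasMatrixResidue_mul_resolventAt
    (G := fun v => G i v * (D.data i.1).Cπ * (D.data q).Bζ) hz (D.data q).nilpotent_ζ (by
      intro a b
      simp only [Matrix.mul_assoc]
      exact HolAt.mul_const (hG i) _ a b)
  have hΓ : ∀ i : D.Poles, D.gammaBlock f i.1 q =
      (if h : i.1 = q then (D.data i.1).S.submatrix id (Fin.cast (by rw [h])) else 0) - K i :=
    fun i => by rw [D.gammaBlock_eq (hGe i), (hK i).eq]
  have hS : ∑ i : D.Poles, u i ᵥ* (if h : i.1 = q then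
      (D.data i.1).S.submatrix id (Fin.cast (by rw [h])) else
        (0 : Matrix (Fin (D.data i.1).nπ) (Fin (D.data q).nζ) ℂ)) =
      D.component u q ᵥ* (D.data q).S := by
    have h := D.sum_poles_eq u q (fun i v => if h : i = q then
      v ᵥ* (D.data i).S.submatrix id (Fin.cast (by rw [h])) else
        (0 : Fin (D.data q).nζ → ℂ)) (by simp)
    rw [dif_pos rfl] at h
    refine Eq.trans (Finset.sum_congr rfl fun i _ => ?_) h
    by_cases hi : i.1 = q
    · simp only [dif_pos hi, if_pos hi]
    · rw [dif_neg hi, if_neg hi, Matrix.vecMul_zero]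
  -- The constant `u₀` contributes `u₀ B_ζ`, since the resolvent has residue `1`; the other terms
  -- contribute `u_i K_i`.
  have hres : HasMatrixResidue (D.coord q) q
      (fun v => replicateRow Unit (u₀ + ∑ i : D.Poles, u i ᵥ* (G i v * (D.data i.1).Cπ)) *
        (D.data q).Bζ * resolventAt (D.coord q) (D.data q).Aζ v)
      (replicateRow Unit (u₀ ᵥ* (D.data q).Bζ + ∑ i : D.Poles, u i ᵥ* K i)) := by
    have h1 := ((hasMatrixResidue_resolventAt hz.mem_source hz.centered
      (D.data q).nilpotent_ζ).const_mul (replicateRow Unit u₀ * (D.data q).Bζ)).add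
      (HasMatrixResidue.sum Finset.univ fun i _ => (hK i).const_mul (replicateRow Unit (u i)))
    convert h1 using 1
    · funext v
      ext a b
      simp only [Matrix.add_apply, Matrix.sum_apply,
        ← Matrix.replicateRow_vecMul, Matrix.replicateRow_apply, Matrix.add_vecMul,
        Matrix.sum_vecMul, Matrix.vecMul_vecMul, Pi.add_apply, Finset.sum_apply, Matrix.mul_assoc]
    · ext a b
      simp only [Matrix.add_apply, Matrix.sum_apply, Matrix.mul_one,
        ← Matrix.replicateRow_vecMul, Matrix.replicateRow_apply, Pi.add_apply, Finset.sum_apply]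
  rw [mem_singularSubspace_iff (D.data q) hz (D.component u q)
    (h := fun v => u₀ + ∑ i : D.Poles, u i ᵥ* (G i v * (D.data i.1).Cπ)), hres.eq,
    Matrix.replicateRow_inj]
  · simp only [hΓ, Matrix.vecMul_sub, Finset.sum_sub_distrib, hS]
    rw [eq_sub_iff_add_eq, eq_comm]
  · intro a
    simp only [Pi.add_apply, Finset.sum_apply]
    refine (holAt_const _ q).add (HolAt.sum _ fun i _ =>
      HolAt.vecMul (fun c => holAt_const (u i c) q) (HolAt.mul_const (hG i) _) a)
  · filter_upwards [eventually_all.mpr hGe] with v hv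
    rw [← D.sum_poles_eq u q (fun i x => x ᵥ* (resolventAt (D.coord i) (D.data i).Aπ v *
      (D.data i).Cπ)) (Matrix.zero_vecMul _), rowFunction, add_left_comm,
      ← Finset.sum_add_distrib]
    congr 1
    refine Finset.sum_congr rfl fun i _ => ?_
    rw [hv i, Matrix.add_mul, Matrix.vecMul_add]
    by_cases hi : i.1 = q
    · rw [if_pos hi, if_pos hi]
    · rw [if_neg hi, if_neg hi, Matrix.zero_mul, Matrix.vecMul_zero]

/-- The global equation `u₀ B_ζ = (u_i) Γ`, one zero at a time. -/
lemma vecMul_zetaRow_eq_iff (f : X → ℕ → X → ℂ) (u₀ : Fin r → ℂ)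
    (u : (i : D.Poles) → Fin (D.data i.1).nπ → ℂ) :
    u₀ ᵥ* D.zetaRow = D.blockRow u ᵥ* D.gamma f ↔ ∀ q ∈ D.support,
      u₀ ᵥ* (D.data q).Bζ = ∑ i : D.Poles, u i ᵥ* D.gammaBlock f i.1 q := by
  have hl : ∀ j b, (u₀ ᵥ* D.zetaRow) ⟨j, b⟩ = (u₀ ᵥ* (D.data j.1).Bζ) b := fun _ _ => rfl
  have hr : ∀ j b, (D.blockRow u ᵥ* D.gamma f) ⟨j, b⟩ =
      (∑ i : D.Poles, u i ᵥ* D.gammaBlock f i.1 j.1) b := by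
    intro j b
    rw [Finset.sum_apply, Matrix.vecMul, dotProduct, Fintype.sum_sigma]
    rfl
  constructor
  · intro h q _
    funext b
    -- An index `b` exists only if `q` is a zero; at other points of the support the equation has no
    -- entries.
    have hq : (D.data q).nζ ≠ 0 := fun e => absurd b.2 (by omega)
    have := congrFun h ⟨⟨q, hq⟩, b⟩
    exact (hl ⟨q, hq⟩ b).symm.trans (this.trans (hr ⟨q, hq⟩ b))
  · intro h
    funext ⟨j, b⟩
    rw [hl, hr, h j.1 (Or.inr j.2)]

end NullPoleDivisor

end NullPole

end

theorem propositionP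
    -- the closed Riemann surface `M` of genus `g ≥ 1`
    {M : Type*} [TopologicalSpace M] [T2Space M] [CompactSpace M] [ConnectedSpace M]
    [ChartedSpace ℂ M] [IsManifold 𝓘(ℂ) ω M]
    (g : ℕ) (hg : genus M = g) (hg1 : 1 ≤ g)
    -- its universal covering `ρ : M' → M`
    {M' : Type*} [TopologicalSpace M'] [T2Space M'] [SimplyConnectedSpace M']
    [ChartedSpace ℂ M'] [IsManifold 𝓘(ℂ) ω M']
    (ρ : M' → M) (hρ : IsCoveringMap ρ) (hρ' : IsLocalDiffeomorph 𝓘(ℂ) 𝓘(ℂ) ω ρ)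
    -- `s q` is the point over `q` in the fundamental domain `M₀ = s(M)`
    (s : M → M') (hs : ∀ q, ρ (s q) = q)
    -- the null-pole divisor and the associated global matrix function
    (r : ℕ) (D : NullPoleDivisor M r)
    (F : M' → Matrix (Fin r) (Fin r) ℂ) (hF : D.IsTrivialization ρ F)
    -- the divisor `D₀ = p₁ + ⋯ + p_g - p₀`
    (p : Fin g → M) (p₀ : M) (hp : IsNonspecial (pointDivisor p)) (hp₀ : ∀ i, p i ≠ p₀)
    (hsupp : ∀ q ∈ D.support, p₀ ≠ q ∧ ∀ i, p i ≠ q)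
    -- the functions `f w k = f^{D₀}_{kw}` at the poles `w` of the divisor
    (f : M → ℕ → M → ℂ)
    (hf : ∀ w, (D.data w).nπ ≠ 0 → ∀ k, 1 ≤ k →
      IsCanonicalFunction (baseDivisor p p₀) w (D.coord w) k (f w k))
    -- the row function `k = u₀ + ∑ u_i f_{u_i, A_π} C_π`
    (u₀ : Fin r → ℂ) (u : (i : D.Poles) → Fin (D.data i.1).nπ → ℂ)
    (k : M → Fin r → ℂ) (hk : k = D.rowFunction f u₀ u) :
    (∀ q ∈ D.support, k ∘ ρ ∈ rowModule F (s q)) ↔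
      u₀ ᵥ* D.zetaRow = D.blockRow u ᵥ* D.gamma f := by
  subst hk
  rw [D.vecMul_zetaRow_eq_iff f u₀ u]
  refine forall₂_congr fun q hq => ?_
  obtain ⟨U, -, hqU, L, H, hL, hH⟩ := hF q
  obtain ⟨hHol, hdet, hFH⟩ := hH (s q) (by rwa [Set.mem_preimage, hs q])
  rw [comp_mem_rowModule_iff (hρ' (s q)) hHol hdet hFH, hs q, (hL q hqU).2.2]
  obtain ⟨h₀, h₁⟩ := hsupp q hq
  exact D.rowFunction_mem_singularSubspace_iff hf u₀ u (baseDivisor_eq_zero h₀ h₁)
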